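/- Let $a<0<b$ and let $g$ be a real function that is real-analytic in a neighbourhood of $[a,b]$ (for example on all of $\mathbb R$), with $g(0)=0$ and $g'(0)=1$. Put $G(x)=\int_0^x g(s)\,ds$, and suppose that $G(a)=G(b)=c$ for some real $c$ and that $G(x)<c$ and $x\,g(x)>0$ for all $a<x<b$, $x\neq 0$. Then there is an analytic involution attached to $G$, that is, a map $A:[a,b]\to[a,b]$, analytic on $(a,b)$, such that $A(A(x))=x$ and $G(A(x))=G(x)$ for all $x\in[a,b]$ and $A(x)\,x<0$ for all $x\in[a,b]$, $x\ne 0$. For every such $A$: (i) the origin is an isochronous center of $\ddot x+g(x)=0$ (that is, all orbits of the system $\dot x=y$, $\dot y=-g(x)$ through points other than the origin in some neighbourhood of the origin are periodic, with one and the same minimal period) if and only if $$\frac{d}{dx}\left[\frac{G(x)}{g(x)^2}\right]=\frac{4A''(x)}{(1-A'(x))^3}\qquad\text{for all } x\in(a,b),\ x\neq 0;$$ (ii) the expression on the right is $A$-invariant: $$\frac{4A''(A(x))}{(1-A'(A(x)))^3}=\frac{4A''(x)}{(1-A'(x))^3}\qquad\text{for all }x\in(a,b).$$ -/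

import Mathlib

open Set

/-- The potential `G(x) = ∫₀ˣ g(s) ds` of the scalar equation `x'' + g(x) = 0`. -/
noncomputable def potential (g : ℝ → ℝ) (x : ℝ) : ℝ := ∫ s in (0 : ℝ)..x, g s

/-- The potential well hypothesis on the interval `[a, b]`: `a < 0 < b`, the values `G(a)` and
`G(b)` are one and the same number `c`, and `G(x) < c`, `x g(x) > 0` for `a < x < b`, `x ≠ 0`. -/
def IsPotentialWell (g : ℝ → ℝ) (a b : ℝ) : Prop :=
  a < 0 ∧ 0 < b ∧ ∃ c : ℝ, potential g a = c ∧ potential g b = c ∧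
    ∀ x : ℝ, a < x → x < b → x ≠ 0 → potential g x < c ∧ 0 < x * g x

/-- `(x, y)` is a solution, defined for all times, of the planar system `x' = y`, `y' = -g(x)`
that is equivalent to `x'' + g(x) = 0`. -/
def IsSolution (g : ℝ → ℝ) (x y : ℝ → ℝ) : Prop :=
  ∀ t : ℝ, HasDerivAt x (y t) t ∧ HasDerivAt y (-g (x t)) t

/-- `T` is the minimal (positive) period of the planar motion `t ↦ (x(t), y(t))`. -/
def HasMinimalPeriod (x y : ℝ → ℝ) (T : ℝ) : Prop :=
  IsLeast {S : ℝ | 0 < S ∧ Function.Periodic (fun t => (x t, y t)) S} T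

/-- The origin is an isochronous center of `x'' + g(x) = 0`: it is an equilibrium of the planar
system `x' = y`, `y' = -g(x)`, all orbits through points near it (other than itself) are periodic,
and they all have the same minimal period `T`. -/
def IsIsochronousCenter (g : ℝ → ℝ) : Prop :=
  g 0 = 0 ∧ ∃ T : ℝ, ∃ ε > 0, ∀ x₀ y₀ : ℝ, |x₀| < ε → |y₀| < ε → (x₀, y₀) ≠ (0, 0) →
    ∃ x y : ℝ → ℝ, IsSolution g x y ∧ x 0 = x₀ ∧ y 0 = y₀ ∧ HasMinimalPeriod x y T

/-- `A` is the analytic involution of the well `[a, b]` attached to the potential `G`: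
it is an involution of `[a, b]`, analytic on `(a, b)`, with `G(A(x)) = G(x)`, and `A(x) x < 0`
for `x ≠ 0`. (The values of `A` outside `[a, b]` play no role.) -/
structure IsPotentialInvolution (g : ℝ → ℝ) (a b : ℝ) (A : ℝ → ℝ) : Prop where
  mapsTo : MapsTo A (Icc a b) (Icc a b)
  involutive : ∀ x ∈ Icc a b, A (A x) = x
  potential_eq : ∀ x ∈ Icc a b, potential g (A x) = potential g x
  mul_neg : ∀ x ∈ Icc a b, x ≠ 0 → A x * x < 0
  analytic : AnalyticOnNhd ℝ A (Ioo a b)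

/-- The expression `4 A''(x) / (1 - A'(x))³`. -/
noncomputable def involutionExpr (A : ℝ → ℝ) (x : ℝ) : ℝ :=
  4 * deriv (deriv A) x / (1 - deriv A x) ^ 3

/-! Since `g'(0) = 1`, the zero of `G` at 0 is exactly double, so the function `u` with the sign of
`x` and `u² = 2G` is an analytic coordinate on the well. With its inverse `φ`, the orbit of energy
`r²/2` is `x = φ(r sin θ)`, `y = r cos θ`, `dt = φ'(r sin θ) dθ`. Its period is the integral of
`φ'(r sin θ)` over a full turn and sees only the even part of `φ'`. An even analytic function whose
averages of this kind vanish for small `r` is zero near 0: otherwise its zeros are isolated and it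
has one sign on a punctured neighbourhood. Hence isochrony means `φ'(v) + φ'(-v) = 2`.

In this coordinate the involution is `v ↦ -v`, that is `A = φ(-u)`, so `1 - A' = u' (φ'(u) +
φ'(-u))` and isochrony becomes `1 - A' = 2u'`. From `g = u u'` follows `G/g² = 1/(2u'²)`, while
`4A''/(1 - A')³` is the derivative of `2/(1 - A')²`. The equation in (i) thus says that these two
functions differ by a constant, which is 0 by their values at the origin. Part (ii) comes from
differentiating `A(A(x)) = x` twice. -/

open Filter Topology MeasureTheory

/-! ### Analyticity of the potential -/

/-- The primitive of a power series, integrated term by term. -/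
theorem HasFPowerSeriesAt.eventually_hasSum_integral {f : ℝ → ℝ}
    {p : FormalMultilinearSeries ℝ ℝ ℝ} {x₀ : ℝ} (hp : HasFPowerSeriesAt f p x₀) :
    ∀ᶠ z in 𝓝 (0 : ℝ),
      HasSum (fun n : ℕ => z ^ (n + 1) * (p.coeff n / (n + 1))) (∫ t in (0 : ℝ)..z, f (x₀ + t)) := by
  obtain ⟨r, hr0, hr⟩ := ENNReal.lt_iff_exists_nnreal_btwn.mp hp.radius_pos
  have hsum := p.summable_norm_mul_pow hr
  have hr0' : (0 : ℝ) < r := by exact_mod_cast hr0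
  obtain ⟨δ, hδ, hball⟩ := Metric.eventually_nhds_iff.mp (hasFPowerSeriesAt_iff.mp hp)
  refine Metric.eventually_nhds_iff.mpr ⟨min δ r, lt_min hδ hr0', fun {z} hz => ?_⟩
  have hz' : |z| < min δ r := by simpa [Real.dist_eq] using hz
  have habs : ∀ t ∈ uIoc 0 z, |t| ≤ |z| := by
    intro t ht
    rcases mem_uIoc.mp ht with h | h
    · rw [abs_of_pos h.1]; exact h.2.trans (le_abs_self z)
    · rw [abs_of_nonpos h.2, abs_of_nonpos (h.1.le.trans h.2)]; linarith [h.1]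
  have key := intervalIntegral.hasSum_integral_of_dominated_convergence (μ := volume) (a := 0)
    (b := z) (F := fun (n : ℕ) t => t ^ n • p.coeff n) (f := fun t => f (x₀ + t))
    (fun n _ => ‖p n‖ * (r : ℝ) ^ n)
    (fun n => (by fun_prop : Continuous fun t : ℝ => t ^ n • p.coeff n).aestronglyMeasurable)
    (fun n => Eventually.of_forall fun t ht => by
      rw [norm_smul, norm_pow, Real.norm_eq_abs, mul_comm,
        FormalMultilinearSeries.norm_apply_eq_norm_coef]
      gcongr
      exact (habs t ht).trans (hz'.le.trans (min_le_right _ _)))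
    (Eventually.of_forall fun _ _ => hsum) (by simp)
    (Eventually.of_forall fun t ht => hball (by
      simpa [Real.dist_eq] using (habs t ht).trans_lt (hz'.trans_le (min_le_left _ _))))
  simp only [smul_eq_mul, intervalIntegral.integral_mul_const, integral_pow] at key
  have hterm : (fun n : ℕ => (z ^ (n + 1) - 0 ^ (n + 1)) / ((n : ℝ) + 1) * p.coeff n) =
      fun n => z ^ (n + 1) * (p.coeff n / (n + 1)) := by
    funext n
    rw [zero_pow n.succ_ne_zero]
    ring
  rw [hterm] at key
  exact key

/-- The integral of an analytic function is analytic as a function of its upper limit. -/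
theorem AnalyticAt.intervalIntegral_self {f : ℝ → ℝ} {x₀ : ℝ} (hf : AnalyticAt ℝ f x₀) :
    AnalyticAt ℝ (fun x => ∫ t in x₀..x, f t) x₀ := by
  obtain ⟨p, hp⟩ := hf
  let d : ℕ → ℝ := fun n => Nat.casesOn n 0 fun m => p.coeff m / (m + 1)
  refine ⟨FormalMultilinearSeries.ofScalars ℝ d, hasFPowerSeriesAt_iff.mpr ?_⟩
  filter_upwards [hp.eventually_hasSum_integral] with z hz
  have h0 : ∫ t in x₀..x₀ + z, f t = ∫ t in (0 : ℝ)..z, f (x₀ + t) := by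
    rw [intervalIntegral.integral_comp_add_left]; simp
  rw [h0]
  refine (hasSum_nat_add_iff' 1).mp ?_
  simpa [d, FormalMultilinearSeries.coeff_ofScalars] using hz

theorem intervalIntegrable_of_analyticOnNhd {g : ℝ → ℝ} {a b x y : ℝ}
    (hg : AnalyticOnNhd ℝ g (Icc a b)) (hx : x ∈ Icc a b) (hy : y ∈ Icc a b) :
    IntervalIntegrable g volume x y :=
  (hg.continuousOn.mono (uIcc_subset_Icc hx hy)).intervalIntegrable

theorem potential_analyticOnNhd {g : ℝ → ℝ} {a b : ℝ} (hg : AnalyticOnNhd ℝ g (Icc a b))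
    (h0 : (0 : ℝ) ∈ Icc a b) : AnalyticOnNhd ℝ (potential g) (Icc a b) := by
  intro x hx
  have h1 : AnalyticAt ℝ (fun y => potential g x + ∫ t in x..y, g t) x :=
    analyticAt_const.add (hg x hx).intervalIntegral_self
  refine h1.congr ?_
  obtain ⟨δ, hδ, hball⟩ := Metric.eventually_nhds_iff_ball.mp (hg x hx).eventually_analyticAt
  filter_upwards [Metric.ball_mem_nhds x hδ] with y hy
  refine intervalIntegral.integral_add_adjacent_intervals
    (intervalIntegrable_of_analyticOnNhd hg h0 hx) (ContinuousOn.intervalIntegrable ?_)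
  intro t ht
  have : uIcc x y ⊆ Metric.ball x δ :=
    (convex_ball x δ).ordConnected.uIcc_subset (Metric.mem_ball_self hδ) hy
  exact (hball t (this ht)).continuousAt.continuousWithinAt

theorem potential_hasDerivAt {g : ℝ → ℝ} {a b x : ℝ} (hg : AnalyticOnNhd ℝ g (Icc a b))
    (h0 : (0 : ℝ) ∈ Icc a b) (hx : x ∈ Icc a b) : HasDerivAt (potential g) (g x) x := by
  refine intervalIntegral.integral_hasDerivAt_right (intervalIntegrable_of_analyticOnNhd hg h0 hx)
    ?_ (hg x hx).continuousAt
  obtain ⟨s, hs, hxs, hsub⟩ : ∃ s : Set ℝ, IsOpen s ∧ x ∈ s ∧ ∀ y ∈ s, AnalyticAt ℝ g y := by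
    obtain ⟨s, h1, h2, h3⟩ := eventually_nhds_iff.mp (hg x hx).eventually_analyticAt
    exact ⟨s, h2, h3, h1⟩
  exact ContinuousAt.stronglyMeasurableAtFilter hs (fun y hy => (hsub y hy).continuousAt) x hxs

/-- An analytic function with a double zero at the origin is `x ^ 2` times an analytic function. -/
theorem AnalyticOnNhd.exists_eq_sq_mul {G : ℝ → ℝ} {s : Set ℝ} (hG : AnalyticOnNhd ℝ G s)
    (h0 : (0 : ℝ) ∈ s) (hG0 : G 0 = 0) (hG1 : deriv G 0 = 0) :
    ∃ k : ℝ → ℝ, AnalyticOnNhd ℝ k s ∧ ∀ x, G x = x ^ 2 * k x := by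
  -- Each `dslope` at 0 divides out one factor `x`.
  have hk : ∀ x, G x = x ^ 2 * dslope (dslope G 0) 0 x := by
    intro x
    have h1 := sub_smul_dslope (dslope G 0) 0 x
    have h2 := sub_smul_dslope G 0 x
    simp only [sub_zero, smul_eq_mul, dslope_same, hG0, hG1] at h1 h2
    rw [← h2, ← h1]; ring
  refine ⟨dslope (dslope G 0) 0, fun x hx => ?_, hk⟩
  by_cases hx0 : x = 0
  · subst hx0
    obtain ⟨p, hp⟩ := hG 0 h0
    exact ⟨_, hp.has_fpower_series_dslope_fslope.has_fpower_series_dslope_fslope⟩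
  · have h1 : AnalyticAt ℝ (fun y => G y / y ^ 2) x :=
      (hG x hx).div (analyticAt_id.pow 2) (pow_ne_zero 2 hx0)
    refine h1.congr ?_
    filter_upwards [isOpen_ne.mem_nhds hx0] with y hy
    have hy' : y ≠ 0 := hy
    rw [hk y]; field_simp

/-! ### The energy coordinate -/

/-- `u` and its inverse `φ` are the coordinate of the well `[a, b]` in which the potential is
`u ^ 2 / 2`. -/
structure IsEnergyCoordinate (g : ℝ → ℝ) (a b R : ℝ) (u φ : ℝ → ℝ) : Prop where
  neg : a < 0
  pos : 0 < b
  radius_pos : 0 < R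
  analytic : AnalyticOnNhd ℝ u (Ioo a b)
  analytic_inv : AnalyticOnNhd ℝ φ (Ioo (-R) R)
  strictMonoOn : StrictMonoOn u (Icc a b)
  left_endpoint : u a = -R
  right_endpoint : u b = R
  mapsTo_inv : MapsTo φ (Icc (-R) R) (Icc a b)
  right_inv : ∀ v ∈ Icc (-R) R, u (φ v) = v
  map_zero : u 0 = 0
  sq_eq : ∀ x ∈ Icc a b, u x ^ 2 = 2 * potential g x
  deriv_pos : ∀ x ∈ Ioo a b, 0 < deriv u x
  deriv_zero : deriv u 0 = 1
  mul_deriv : ∀ x ∈ Ioo a b, u x * deriv u x = g x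

theorem potential_pos {g : ℝ → ℝ} {a b : ℝ} (hg : AnalyticOnNhd ℝ g (Icc a b))
    (hwell : IsPotentialWell g a b) {x : ℝ} (hx : x ∈ Icc a b) (hx0 : x ≠ 0) :
    0 < potential g x := by
  obtain ⟨ha, hb, c, -, -, h⟩ := hwell
  have h0 : (0 : ℝ) ∈ Icc a b := ⟨ha.le, hb.le⟩
  rcases lt_or_gt_of_ne hx0 with hneg | hpos
  · have h1 : 0 < ∫ s in x..0, -g s := by
      refine intervalIntegral.intervalIntegral_pos_of_pos_on
        (intervalIntegrable_of_analyticOnNhd hg hx h0).neg (fun s hs => ?_) hneg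
      have := (h s (hx.1.trans_lt hs.1) (hs.2.trans hb) hs.2.ne).2
      nlinarith [hs.2]
    rw [intervalIntegral.integral_neg, ← intervalIntegral.integral_symm] at h1
    exact h1
  · refine intervalIntegral.intervalIntegral_pos_of_pos_on
      (intervalIntegrable_of_analyticOnNhd hg h0 hx) (fun s hs => ?_) hpos
    have := (h s (ha.trans hs.1) (hs.2.trans_le hx.2) hs.1.ne').2
    exact pos_of_mul_pos_right this hs.1.le

/-- Writing `G = x² k` with `k > 0` avoids the singular square root of `2G` at the origin: `u = x
√(2k)` is analytic throughout. -/
theorem exists_isEnergyCoordinate {g : ℝ → ℝ} {a b : ℝ}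
    (hg : AnalyticOnNhd ℝ g (Icc a b)) (hg0 : g 0 = 0) (hg1 : deriv g 0 = 1)
    (hwell : IsPotentialWell g a b) : ∃ R u φ, IsEnergyCoordinate g a b R u φ := by
  have hpot := fun {x} => potential_pos (x := x) hg hwell
  obtain ⟨ha, hb, c, hac, hbc, h⟩ := hwell
  have h0 : (0 : ℝ) ∈ Icc a b := ⟨ha.le, hb.le⟩
  have h0' : (0 : ℝ) ∈ Ioo a b := ⟨ha, hb⟩
  have hc : 0 < c := hbc ▸ hpot ⟨(ha.trans hb).le, le_rfl⟩ hb.ne'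
  obtain ⟨k, hk, hGk⟩ := (potential_analyticOnNhd hg h0).exists_eq_sq_mul h0
    (by simp [potential]) (by rw [(potential_hasDerivAt hg h0 h0).deriv, hg0])
  -- Near 0, `g = G' = x (2k + x k')`, so `g'(0) = 2 k(0)`.
  have hk0 : k 0 = 1 / 2 := by
    have h1 : g =ᶠ[𝓝 0] fun x => x * (2 * k x + x * deriv k x) := by
      filter_upwards [isOpen_Ioo.mem_nhds h0'] with x hx
      have hx' := Ioo_subset_Icc_self hx
      have h2 := (hasDerivAt_pow 2 x).mul (hk x hx').differentiableAt.hasDerivAt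
      have h3 : HasDerivAt (potential g) _ x := h2.congr_of_eventuallyEq
        (Eventually.of_forall hGk)
      rw [(potential_hasDerivAt hg h0 hx').unique h3]
      simp; ring
    have h2 : DifferentiableAt ℝ (fun x => 2 * k x + x * deriv k x) 0 :=
      ((hk 0 h0).differentiableAt.const_mul 2).add
        (differentiableAt_id.mul (hk 0 h0).deriv.differentiableAt)
    have h3 := ((hasDerivAt_id (0 : ℝ)).mul h2.hasDerivAt).congr_of_eventuallyEq h1
    have h4 := h3.deriv
    rw [hg1] at h4
    simp at h4
    linarith
  have hkpos : ∀ x ∈ Icc a b, 0 < k x := by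
    intro x hx
    by_cases hx0 : x = 0
    · subst hx0; rw [hk0]; norm_num
    · have := hpot hx hx0
      rw [hGk] at this
      exact pos_of_mul_pos_right this (sq_nonneg x)
  set s : ℝ → ℝ := fun x => √(2 * k x) with hs
  have hspos : ∀ x ∈ Icc a b, 0 < s x := fun x hx => Real.sqrt_pos.mpr (by linarith [hkpos x hx])
  have hsan : AnalyticOnNhd ℝ s (Icc a b) := by
    intro x hx
    have h1 : AnalyticAt ℝ (fun y : ℝ => √y) (2 * k x) :=
      (Real.contDiffAt_sqrt (by linarith [hkpos x hx])).analyticAt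
    exact h1.comp (f := fun x => 2 * k x) (analyticAt_const.mul (hk x hx))
  set u : ℝ → ℝ := fun x => x * s x with hu
  have huan : AnalyticOnNhd ℝ u (Icc a b) := fun x hx => analyticAt_id.mul (hsan x hx)
  have hsq : ∀ x ∈ Icc a b, u x ^ 2 = 2 * potential g x := by
    intro x hx
    rw [hGk, hu, mul_pow, hs, Real.sq_sqrt (by linarith [hkpos x hx])]; ring
  have hmul : ∀ x ∈ Ioo a b, u x * deriv u x = g x := by
    intro x hx
    have hx' := Ioo_subset_Icc_self hx
    have h1 := (huan x hx').differentiableAt.hasDerivAt.pow 2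
    have h2 : HasDerivAt (fun y => u y ^ 2) (2 * g x) x :=
      ((potential_hasDerivAt hg h0 hx').const_mul 2).congr_of_eventuallyEq
        (by filter_upwards [isOpen_Ioo.mem_nhds hx] with y hy
            exact hsq y (Ioo_subset_Icc_self hy))
    have h3 := h1.unique h2
    simp at h3
    linarith
  have hd0 : deriv u 0 = 1 := by
    have h1 := ((hasDerivAt_id (0 : ℝ)).mul (hsan 0 h0).differentiableAt.hasDerivAt).deriv
    have h2 : deriv u 0 = s 0 := h1.trans (by simp)
    rw [h2, hs]; simp [hk0]
  have hdpos : ∀ x ∈ Ioo a b, 0 < deriv u x := by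
    intro x hx
    by_cases hx0 : x = 0
    · subst hx0; rw [hd0]; norm_num
    · have h1 := (h x hx.1 hx.2 hx0).2
      rw [← hmul x hx] at h1
      have h2 : 0 < (x ^ 2 * s x) * deriv u x := by
        calc 0 < x * (u x * deriv u x) := h1
          _ = _ := by simp only [hu]; ring
      exact pos_of_mul_pos_right h2
        (mul_nonneg (sq_nonneg x) (hspos x (Ioo_subset_Icc_self hx)).le)
  have hmono : StrictMonoOn u (Icc a b) :=
    strictMonoOn_of_deriv_pos (convex_Icc a b) huan.continuousOn (by rwa [interior_Icc])
  have haI : a ∈ Icc a b := ⟨le_rfl, (ha.trans hb).le⟩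
  have hbI : b ∈ Icc a b := ⟨(ha.trans hb).le, le_rfl⟩
  have hua : u a = -√(2 * c) := by
    rw [← hac, ← hsq a haI, Real.sqrt_sq_eq_abs,
      abs_of_neg (mul_neg_of_neg_of_pos ha (hspos a haI)), neg_neg]
  have hub : u b = √(2 * c) := by
    rw [← hbc, ← hsq b hbI, Real.sqrt_sq_eq_abs, abs_of_pos (mul_pos hb (hspos b hbI))]
  have hsurj : SurjOn u (Icc a b) (Icc (-√(2 * c)) (√(2 * c))) := by
    have := huan.continuousOn.surjOn_Icc haI hbI
    rwa [hua, hub] at this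
  set φ : ℝ → ℝ := Function.invFunOn u (Icc a b) with hφ
  have hright : ∀ v ∈ Icc (-√(2 * c)) (√(2 * c)), u (φ v) = v :=
    fun v hv => Function.invFunOn_eq (hsurj hv)
  have hmaps : MapsTo φ (Icc (-√(2 * c)) (√(2 * c))) (Icc a b) :=
    fun v hv => Function.invFunOn_mem (hsurj hv)
  refine ⟨√(2 * c), u, φ, ha, hb, by positivity, huan.mono Ioo_subset_Icc_self, ?_, hmono,
    hua, hub, hmaps, hright, by simp [hu], hsq, hdpos, hd0, hmul⟩
  intro v hv
  have hv' := Ioo_subset_Icc_self hv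
  have hφv : φ v ∈ Ioo a b := by
    refine ⟨(hmaps hv').1.lt_of_ne fun he => ?_, (hmaps hv').2.lt_of_ne fun he => ?_⟩
    · have := hright v hv'
      rw [← he, hua] at this
      exact hv.1.ne this
    · have := hright v hv'
      rw [he, hub] at this
      exact hv.2.ne' this
  -- As `u' ≠ 0`, analyticity of `φ` at `u(φ v)` is that of `φ ∘ u` at `φ v`, which is locally the
  -- identity.
  rw [← hright v hv', ← analyticAt_comp_iff_of_deriv_ne_zero (huan _ (hmaps hv'))
    (hdpos _ hφv).ne']
  refine analyticAt_id.congr ?_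
  filter_upwards [isOpen_Ioo.mem_nhds hφv] with x hx
  exact (hmono.injOn.leftInvOn_invFunOn (Ioo_subset_Icc_self hx)).symm

/-! ### Closed orbits and their periods -/

/-- The primitive of a positive continuous periodic function has a differentiable inverse. -/
theorem Function.Periodic.exists_inverse_primitive {w : ℝ → ℝ} {T : ℝ}
    (hper : Function.Periodic w T) (hT : 0 < T) (hw : Continuous w) (hpos : ∀ s, 0 < w s) :
    ∃ θ : ℝ → ℝ, StrictMono θ ∧ (∀ s, θ (∫ r in (0 : ℝ)..s, w r) = s) ∧
      (∀ t, HasDerivAt θ (w (θ t))⁻¹ t) ∧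
      ∀ t, θ (t + ∫ r in (0 : ℝ)..T, w r) = θ t + T := by
  have hint : ∀ x y, IntervalIntegrable w volume x y := fun x y => hw.intervalIntegrable x y
  have hderiv : ∀ s, HasDerivAt (fun s => ∫ r in (0 : ℝ)..s, w r) (w s) s :=
    fun s => intervalIntegral.integral_hasDerivAt_right (hint _ _)
      (hw.stronglyMeasurableAtFilter _ _) hw.continuousAt
  have hmono : StrictMono fun s => ∫ r in (0 : ℝ)..s, w r :=
    strictMono_of_deriv_pos fun s => by rw [(hderiv s).deriv]; exact hpos s
  have hcont : Continuous fun s => ∫ r in (0 : ℝ)..s, w r :=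
    continuous_iff_continuousAt.mpr fun s => (hderiv s).continuousAt
  have hsurj : Function.Surjective fun s => ∫ r in (0 : ℝ)..s, w r :=
    hcont.surjective (hper.tendsto_atTop_intervalIntegral_of_pos' (hint _ _) hpos hT)
      (hper.tendsto_atBot_intervalIntegral_of_pos' (hint _ _) hpos hT)
  let e := hmono.orderIsoOfSurjective _ hsurj
  have hleft : ∀ s, e.symm (∫ r in (0 : ℝ)..s, w r) = s := fun s => e.symm_apply_apply s
  have hright : ∀ t, ∫ r in (0 : ℝ)..e.symm t, w r = t := fun t => e.apply_symm_apply t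
  refine ⟨e.symm, e.symm.strictMono, hleft, fun t => ?_, fun t => ?_⟩
  · exact (hderiv (e.symm t)).of_local_left_inverse e.symm.continuous.continuousAt
      (hpos _).ne' (Eventually.of_forall hright)
  · have hsum : ∫ r in (0 : ℝ)..e.symm t + T, w r = t + ∫ r in (0 : ℝ)..T, w r := by
      rw [← intervalIntegral.integral_add_adjacent_intervals (hint 0 (e.symm t)) (hint _ _),
        hright, hper.intervalIntegral_add_eq (e.symm t) 0, zero_add]
    rw [← hsum, hleft]

theorem Function.Periodic.const_mul_sin (f : ℝ → ℝ) (r : ℝ) :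
    Function.Periodic (fun s => f (r * Real.sin s)) (2 * Real.pi) :=
  fun s => by simp [Real.sin_add_two_pi]

theorem mul_sin_mem_Ioo {r R : ℝ} (hr : 0 < r) (hrR : r < R) (s : ℝ) :
    r * Real.sin s ∈ Ioo (-R) R := by
  have h1 := Real.neg_one_le_sin s
  have h2 := Real.sin_le_one s
  constructor <;> nlinarith

theorem continuous_comp_mul_sin {f : ℝ → ℝ} {r R : ℝ} (hf : ContinuousOn f (Ioo (-R) R))
    (hr : 0 < r) (hrR : r < R) : Continuous fun s => f (r * Real.sin s) :=
  hf.comp_continuous (by fun_prop) (mul_sin_mem_Ioo hr hrR)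

namespace IsEnergyCoordinate

variable {g u φ : ℝ → ℝ} {a b R : ℝ}

theorem zero_mem (h : IsEnergyCoordinate g a b R u φ) : (0 : ℝ) ∈ Ioo a b := ⟨h.neg, h.pos⟩

theorem zero_mem' (h : IsEnergyCoordinate g a b R u φ) : (0 : ℝ) ∈ Ioo (-R) R :=
  ⟨neg_neg_iff_pos.mpr h.radius_pos, h.radius_pos⟩

theorem mapsTo (h : IsEnergyCoordinate g a b R u φ) : MapsTo u (Icc a b) (Icc (-R) R) := by
  have hab := (h.neg.trans h.pos).le
  intro x hx
  rw [← h.left_endpoint, ← h.right_endpoint]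
  exact ⟨h.strictMonoOn.monotoneOn ⟨le_rfl, hab⟩ hx hx.1,
    h.strictMonoOn.monotoneOn hx ⟨hab, le_rfl⟩ hx.2⟩

theorem mapsTo_Ioo (h : IsEnergyCoordinate g a b R u φ) : MapsTo u (Ioo a b) (Ioo (-R) R) := by
  have hab := (h.neg.trans h.pos).le
  intro x hx
  rw [← h.left_endpoint, ← h.right_endpoint]
  exact ⟨h.strictMonoOn ⟨le_rfl, hab⟩ (Ioo_subset_Icc_self hx) hx.1,
    h.strictMonoOn (Ioo_subset_Icc_self hx) ⟨hab, le_rfl⟩ hx.2⟩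

theorem left_inv (h : IsEnergyCoordinate g a b R u φ) {x : ℝ} (hx : x ∈ Icc a b) :
    φ (u x) = x :=
  h.strictMonoOn.injOn (h.mapsTo_inv (h.mapsTo hx)) hx (h.right_inv _ (h.mapsTo hx))

theorem mapsTo_inv_Ioo (h : IsEnergyCoordinate g a b R u φ) :
    MapsTo φ (Ioo (-R) R) (Ioo a b) := by
  intro v hv
  have hv' := Ioo_subset_Icc_self hv
  have h1 := h.right_inv v hv'
  refine ⟨(h.mapsTo_inv hv').1.lt_of_ne fun he => ?_, (h.mapsTo_inv hv').2.lt_of_ne fun he => ?_⟩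
  · rw [← he, h.left_endpoint] at h1
    exact hv.1.ne h1
  · rw [he, h.right_endpoint] at h1
    exact hv.2.ne' h1

theorem inv_zero (h : IsEnergyCoordinate g a b R u φ) : φ 0 = 0 := by
  have := h.left_inv (Ioo_subset_Icc_self h.zero_mem)
  rwa [h.map_zero] at this

theorem hasDerivAt (h : IsEnergyCoordinate g a b R u φ) {x : ℝ} (hx : x ∈ Ioo a b) :
    HasDerivAt u (deriv u x) x := (h.analytic x hx).differentiableAt.hasDerivAt

theorem hasDerivAt_inv (h : IsEnergyCoordinate g a b R u φ) {v : ℝ} (hv : v ∈ Ioo (-R) R) :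
    HasDerivAt φ (deriv φ v) v := (h.analytic_inv v hv).differentiableAt.hasDerivAt

theorem deriv_mul_deriv_inv (h : IsEnergyCoordinate g a b R u φ) {v : ℝ}
    (hv : v ∈ Ioo (-R) R) : deriv u (φ v) * deriv φ v = 1 := by
  have h1 := (h.hasDerivAt (h.mapsTo_inv_Ioo hv)).comp v (h.hasDerivAt_inv hv)
  refine h1.unique ((hasDerivAt_id v).congr_of_eventuallyEq ?_)
  filter_upwards [isOpen_Ioo.mem_nhds hv] with y hy
  exact h.right_inv y (Ioo_subset_Icc_self hy)

theorem deriv_inv_pos (h : IsEnergyCoordinate g a b R u φ) {v : ℝ}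
    (hv : v ∈ Ioo (-R) R) : 0 < deriv φ v := by
  have h1 := h.deriv_mul_deriv_inv hv
  exact pos_of_mul_pos_right (by rw [h1]; exact one_pos)
    (h.deriv_pos _ (h.mapsTo_inv_Ioo hv)).le

theorem force_mul_deriv_inv (h : IsEnergyCoordinate g a b R u φ) {v : ℝ}
    (hv : v ∈ Ioo (-R) R) : g (φ v) * deriv φ v = v := by
  rw [← h.mul_deriv _ (h.mapsTo_inv_Ioo hv), mul_assoc, h.deriv_mul_deriv_inv hv, mul_one,
    h.right_inv v (Ioo_subset_Icc_self hv)]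

theorem continuousOn_deriv_inv (h : IsEnergyCoordinate g a b R u φ) :
    ContinuousOn (deriv φ) (Ioo (-R) R) := h.analytic_inv.deriv.continuousOn

/-- The closed orbit of energy `r ^ 2 / 2`, parametrized by its angle in the energy coordinate. -/
theorem exists_isSolution (h : IsEnergyCoordinate g a b R u φ) {r : ℝ} (hr : 0 < r)
    (hrR : r < R) (α : ℝ) :
    ∃ x y : ℝ → ℝ, IsSolution g x y ∧ x 0 = φ (r * Real.sin α) ∧ y 0 = r * Real.cos α ∧
      HasMinimalPeriod x y (∫ s in (0 : ℝ)..2 * Real.pi, deriv φ (r * Real.sin s)) ∧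
      ∀ t, x t ∈ Ioo a b := by
  have hmem := mul_sin_mem_Ioo hr hrR
  have hwpos : ∀ s, 0 < deriv φ (r * Real.sin s) := fun s => h.deriv_inv_pos (hmem s)
  have hwcont := continuous_comp_mul_sin h.continuousOn_deriv_inv hr hrR
  obtain ⟨θ, hmono, hleft, hder, hadd⟩ :=
    (Function.Periodic.const_mul_sin (deriv φ) r).exists_inverse_primitive Real.two_pi_pos
      hwcont hwpos
  set P := ∫ s in (0 : ℝ)..2 * Real.pi, deriv φ (r * Real.sin s) with hP
  have hPpos : 0 < P := intervalIntegral.intervalIntegral_pos_of_pos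
    (hwcont.intervalIntegrable _ _) hwpos Real.two_pi_pos
  -- The time at which the angle is `α`; shifting by it puts angle `α` at time 0.
  set t₀ := ∫ s in (0 : ℝ)..α, deriv φ (r * Real.sin s) with ht₀
  have hθ₀ : θ t₀ = α := hleft α
  refine ⟨fun t => φ (r * Real.sin (θ (t + t₀))), fun t => r * Real.cos (θ (t + t₀)), fun t => ?_,
    by simp [hθ₀], by simp [hθ₀], ⟨⟨hPpos, fun t => ?_⟩, ?_⟩, fun t => h.mapsTo_inv_Ioo (hmem _)⟩
  · have hθ : HasDerivAt (fun t => θ (t + t₀)) (deriv φ (r * Real.sin (θ (t + t₀))))⁻¹ t :=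
      (hder (t + t₀)).comp_add_const t t₀
    have hne := (hwpos (θ (t + t₀))).ne'
    constructor
    · have h1 := (h.hasDerivAt_inv (hmem (θ (t + t₀)))).comp t (hθ.sin.const_mul r)
      refine HasDerivAt.congr_deriv (f := fun t => φ (r * Real.sin (θ (t + t₀)))) h1 ?_
      field_simp
    · refine (hθ.cos.const_mul r).congr_deriv ?_
      have h2 := h.force_mul_deriv_inv (hmem (θ (t + t₀)))
      field_simp
      linarith
  · have h1 : θ (t + P + t₀) = θ (t + t₀) + 2 * Real.pi := by
      rw [← hadd]; congr 1; ring
    simp [h1]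
  -- A return after time `S > 0` repeats both sine and cosine, so the increasing angle has gained at
  -- least one full turn.
  · rintro S ⟨hS, hper⟩
    have h1 := hper 0
    simp only [zero_add, Prod.mk.injEq, hθ₀] at h1
    have hsin : Real.sin (θ (S + t₀)) = Real.sin α := by
      have h2 := congrArg u h1.1
      rw [h.right_inv _ (Ioo_subset_Icc_self (hmem _)),
        h.right_inv _ (Ioo_subset_Icc_self (hmem _))] at h2
      exact mul_left_cancel₀ hr.ne' h2
    have hcos : Real.cos (θ (S + t₀)) = Real.cos α := mul_left_cancel₀ hr.ne' h1.2
    obtain ⟨k, hk⟩ := Real.Angle.angle_eq_iff_two_pi_dvd_sub.mp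
      (Real.Angle.cos_sin_inj hcos hsin)
    have hlt : α < θ (S + t₀) := by
      rw [← hθ₀]; exact hmono (by linarith)
    have hk1 : (1 : ℝ) ≤ k := by
      have h3 : (0 : ℝ) < k := by
        by_contra hk0
        nlinarith [Real.two_pi_pos, not_lt.mp hk0]
      exact_mod_cast h3
    have h4 : θ (t₀ + P) ≤ θ (S + t₀) := by
      rw [hadd, hθ₀]
      nlinarith [Real.two_pi_pos]
    have := hmono.le_iff_le.mp h4
    linarith

end IsEnergyCoordinate

/-- Uniqueness of solutions: one of the two is required to stay where `g` is analytic. -/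
theorem IsSolution.unique {g x y x' y' : ℝ → ℝ} {a b : ℝ} (hg : AnalyticOnNhd ℝ g (Ioo a b))
    (h : IsSolution g x y) (h' : IsSolution g x' y') (hmem : ∀ t, x' t ∈ Ioo a b)
    (hx : x 0 = x' 0) (hy : y 0 = y' 0) : x = x' ∧ y = y' := by
  let v : ℝ × ℝ → ℝ × ℝ := fun p => (p.2, -g p.1)
  have hd : ∀ {x y : ℝ → ℝ}, IsSolution g x y → ∀ t,
      HasDerivAt (fun t => (x t, y t)) (v (x t, y t)) t := fun h t => (h t).1.prodMk (h t).2
  have hc : ∀ {x y : ℝ → ℝ}, IsSolution g x y → Continuous fun t => (x t, y t) :=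
    fun h => continuous_iff_continuousAt.mpr fun t => (hd h t).continuousAt
  have hclosed : IsClosed {t | (x t, y t) = (x' t, y' t)} := isClosed_eq (hc h) (hc h')
  -- At an agreement time both curves enter a neighbourhood where the field is Lipschitz, so only
  -- one of them needs a confinement hypothesis.
  have hopen : IsOpen {t | (x t, y t) = (x' t, y' t)} := by
    refine isOpen_iff_mem_nhds.mpr fun t ht => ?_
    have hv : ContDiffAt ℝ 1 v (x' t, y' t) := by
      refine contDiffAt_snd.prodMk (ContDiffAt.neg ?_)
      exact ((hg _ (hmem t)).contDiffAt (n := 1)).comp (x' t, y' t) contDiffAt_fst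
    obtain ⟨K, s, hs, hK⟩ := hv.exists_lipschitzOnWith
    refine ODE_solution_unique_of_eventually (v := fun _ => v) (s := fun _ => s) (K := K)
      (Eventually.of_forall fun _ => hK) ?_ ?_ ht
    · have hs' : s ∈ 𝓝 (x t, y t) := by rw [show (x t, y t) = (x' t, y' t) from ht]; exact hs
      filter_upwards [(hc h).continuousAt.preimage_mem_nhds hs'] with τ hτ using ⟨hd h τ, hτ⟩
    · filter_upwards [(hc h').continuousAt.preimage_mem_nhds hs] with τ hτ using ⟨hd h' τ, hτ⟩
  have huniv := IsClopen.eq_univ ⟨hclosed, hopen⟩ ⟨0, by simp [hx, hy]⟩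
  have hall : ∀ t, (x t, y t) = (x' t, y' t) := fun t =>
    (huniv.symm ▸ mem_univ t : t ∈ {t | (x t, y t) = (x' t, y' t)})
  exact ⟨funext fun t => (Prod.mk.inj (hall t)).1, funext fun t => (Prod.mk.inj (hall t)).2⟩

/-! ### Averages along `r sin s` -/

/-- The half-turn `s ↦ s + π` changes the sign of `sin s` and preserves integrals over a period. -/
theorem integral_add_comp_neg_mul_sin {f : ℝ → ℝ} {r R : ℝ} (hf : ContinuousOn f (Ioo (-R) R))
    (hr : 0 < r) (hrR : r < R) :
    ∫ s in (0 : ℝ)..2 * Real.pi, (f (r * Real.sin s) + f (-(r * Real.sin s))) =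
      2 * ∫ s in (0 : ℝ)..2 * Real.pi, f (r * Real.sin s) := by
  have hc := continuous_comp_mul_sin hf hr hrR
  have hneg : ∀ s, f (-(r * Real.sin s)) = f (r * Real.sin (s + Real.pi)) := fun s => by
    rw [Real.sin_add_pi, mul_neg]
  have hc' : Continuous fun s => f (r * Real.sin (s + Real.pi)) :=
    hc.comp (continuous_id.add continuous_const)
  simp_rw [hneg]
  rw [intervalIntegral.integral_add (hc.intervalIntegrable _ _) (hc'.intervalIntegrable _ _),
    intervalIntegral.integral_comp_add_right (fun s => f (r * Real.sin s)), zero_add,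
    add_comm (2 * Real.pi) Real.pi,
    (Function.Periodic.const_mul_sin f r).intervalIntegral_add_eq Real.pi 0, zero_add]
  ring

theorem integral_mul_sin_pos {h : ℝ → ℝ} {r R : ℝ} (hc : ContinuousOn h (Ioo (-R) R))
    (heven : ∀ v, h (-v) = h v) (hpos : ∀ v ∈ Ioo 0 R, 0 < h v) (hr : 0 < r) (hrR : r < R) :
    0 < ∫ s in (0 : ℝ)..2 * Real.pi, h (r * Real.sin s) := by
  have hcs := continuous_comp_mul_sin hc hr hrR
  have hmem := mul_sin_mem_Ioo hr hrR
  rw [← intervalIntegral.integral_add_adjacent_intervals (hcs.intervalIntegrable 0 Real.pi)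
    (hcs.intervalIntegrable _ _)]
  refine add_pos ?_ ?_
  · refine intervalIntegral.intervalIntegral_pos_of_pos_on (hcs.intervalIntegrable _ _)
      (fun s hs => hpos _ ⟨mul_pos hr (Real.sin_pos_of_pos_of_lt_pi hs.1 hs.2), (hmem s).2⟩)
      Real.pi_pos
  · refine intervalIntegral.intervalIntegral_pos_of_pos_on (hcs.intervalIntegrable _ _)
      (fun s hs => ?_) (by linarith [Real.pi_pos])
    have h1 : Real.sin s < 0 := by
      have := Real.sin_pos_of_pos_of_lt_pi (x := s - Real.pi) (by linarith [hs.1])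
        (by linarith [hs.2])
      rw [Real.sin_sub_pi] at this
      linarith
    rw [← heven]
    exact hpos _ ⟨by nlinarith, by linarith [(hmem s).1]⟩

/-- An even analytic function whose averages along `s ↦ r sin s` vanish for small `r` vanishes
near the origin. -/
theorem AnalyticOnNhd.eventually_eq_zero_of_integral_mul_sin {h : ℝ → ℝ} {R : ℝ} (hR : 0 < R)
    (hh : AnalyticOnNhd ℝ h (Ioo (-R) R)) (heven : ∀ v, h (-v) = h v)
    (hint : ∀ r, 0 < r → r < R → ∫ s in (0 : ℝ)..2 * Real.pi, h (r * Real.sin s) = 0) :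
    ∀ᶠ v in 𝓝 0, h v = 0 := by
  refine (hh 0 ⟨neg_neg_iff_pos.mpr hR, hR⟩).eventually_eq_zero_or_eventually_ne_zero.resolve_right
    fun hne => ?_
  obtain ⟨δ, hδ, hball⟩ := Metric.eventually_nhds_iff.mp (eventually_nhdsWithin_iff.mp hne)
  set ρ := min δ R with hρ
  have hρ0 : 0 < ρ := lt_min hδ hR
  have hcont : ContinuousOn h (Ioo (-ρ) ρ) := hh.continuousOn.mono
    (Ioo_subset_Ioo (neg_le_neg (min_le_right _ _)) (min_le_right _ _))
  have hcont' : ContinuousOn h (Ioo 0 ρ) := hcont.mono (Ioo_subset_Ioo (by linarith) le_rfl)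
  have hne' : (0 : ℝ) ∉ h '' Ioo 0 ρ := by
    rintro ⟨v, hv, hv0⟩
    refine hball (y := v) ?_ hv.1.ne' hv0
    rw [Real.dist_eq, sub_zero, abs_of_pos hv.1]
    exact hv.2.trans_le (min_le_left _ _)
  have hm : ρ / 2 ∈ Ioo 0 ρ := ⟨by linarith, by linarith⟩
  have hint' := hint (ρ / 2) hm.1 (hm.2.trans_le (min_le_right _ _))
  rcases lt_trichotomy (h (ρ / 2)) 0 with h1 | h1 | h1
  · have hpos : ∀ v ∈ Ioo 0 ρ, 0 < -h v := fun v hv => by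
      by_contra hv0
      exact hne' (isPreconnected_Ioo.intermediate_value hm hv hcont' ⟨h1.le, by linarith⟩)
    have := integral_mul_sin_pos hcont.neg (fun v => congrArg Neg.neg (heven v)) hpos hm.1 hm.2
    simp [hint'] at this
  · exact hne' ⟨_, hm, h1⟩
  · have hpos : ∀ v ∈ Ioo 0 ρ, 0 < h v := fun v hv => by
      by_contra hv0
      exact hne' (isPreconnected_Ioo.intermediate_value hv hm hcont' ⟨by linarith, h1.le⟩)
    exact (integral_mul_sin_pos hcont heven hpos hm.1 hm.2).ne' hint'

/-! ### Isochrony and the even part of `φ'` -/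

namespace IsEnergyCoordinate

variable {g u φ : ℝ → ℝ} {a b R : ℝ}

theorem deriv_inv_zero (h : IsEnergyCoordinate g a b R u φ) : deriv φ 0 = 1 := by
  have := h.deriv_mul_deriv_inv h.zero_mem'
  rwa [h.inv_zero, h.deriv_zero, one_mul] at this

theorem neg_mem {v : ℝ} (hv : v ∈ Ioo (-R) R) : -v ∈ Ioo (-R) R :=
  ⟨by linarith [hv.2], by linarith [hv.1]⟩

theorem deriv_inv_add_of_isIsochronousCenter (h : IsEnergyCoordinate g a b R u φ)
    (hg : AnalyticOnNhd ℝ g (Ioo a b)) (hiso : IsIsochronousCenter g) :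
    ∀ v ∈ Ioo (-R) R, deriv φ v + deriv φ (-v) = 2 := by
  obtain ⟨-, T, ε, hε, hper⟩ := hiso
  have hT : ∀ r, 0 < r → r < min ε R →
      ∫ s in (0 : ℝ)..2 * Real.pi, deriv φ (r * Real.sin s) = T := by
    intro r hr hrε
    obtain ⟨x, y, hsol, hx0, hy0, hmin⟩ := hper 0 r (by simpa using hε)
      (by rw [abs_of_pos hr]; exact hrε.trans_le (min_le_left _ _)) (by simp [hr.ne'])
    obtain ⟨x', y', hsol', hx0', hy0', hmin', hmem⟩ :=
      h.exists_isSolution hr (hrε.trans_le (min_le_right _ _)) 0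
    obtain ⟨rfl, rfl⟩ := hsol.unique hg hsol' hmem (by simp [hx0, hx0', h.inv_zero])
      (by simp [hy0, hy0'])
    exact hmin'.unique hmin
  -- The two summands have total integral `2T` over length `2π`; subtracting the mean `T/π` makes
  -- the averages vanish.
  set k : ℝ → ℝ := fun v => deriv φ v + deriv φ (-v) - T / Real.pi with hk
  have hkan : AnalyticOnNhd ℝ k (Ioo (-R) R) := by
    intro v hv
    have h1 := h.analytic_inv.deriv v hv
    have h2 : AnalyticAt ℝ (fun v => deriv φ (-v)) v :=
      (h.analytic_inv.deriv (-v) (neg_mem hv)).comp (f := fun v : ℝ => -v) analyticAt_id.neg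
    exact (h1.add h2).sub analyticAt_const
  have hρ : 0 < min ε R := lt_min hε h.radius_pos
  have hsub : Ioo (-min ε R) (min ε R) ⊆ Ioo (-R) R :=
    Ioo_subset_Ioo (neg_le_neg (min_le_right _ _)) (min_le_right _ _)
  have hzero : ∀ᶠ v in 𝓝 0, k v = 0 := by
    refine (hkan.mono hsub).eventually_eq_zero_of_integral_mul_sin hρ (fun v => ?_) ?_
    · simp only [hk, neg_neg]; ring
    · intro r hr hrε
      have hc := h.continuousOn_deriv_inv.mono hsub
      have hc1 := continuous_comp_mul_sin hc hr hrε
      have hc2 : Continuous fun s => deriv φ (-(r * Real.sin s)) := by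
        have := hc1.comp (continuous_id.add (continuous_const (y := Real.pi)))
        simpa [Function.comp_def, Real.sin_add_pi] using this
      simp only [hk]
      have hc3 : Continuous fun s => deriv φ (r * Real.sin s) + deriv φ (-(r * Real.sin s)) :=
        hc1.add hc2
      rw [intervalIntegral.integral_sub (hc3.intervalIntegrable _ _) intervalIntegrable_const,
        integral_add_comp_neg_mul_sin hc hr hrε, hT r hr hrε]
      simp
      field_simp
      ring
  -- The identity theorem spreads the local vanishing to all of `(-R, R)`; the value at 0 then gives
  -- `T/π = 2`.
  have heq := hkan.eqOn_of_preconnected_of_eventuallyEq analyticOnNhd_const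
    isPreconnected_Ioo h.zero_mem' hzero
  intro v hv
  have h1 : deriv φ v + deriv φ (-v) - T / Real.pi = 0 := heq hv
  have h2 : deriv φ 0 + deriv φ (-0) - T / Real.pi = 0 := heq h.zero_mem'
  rw [neg_zero, h.deriv_inv_zero] at h2
  linarith

theorem isIsochronousCenter_of_deriv_inv_add (h : IsEnergyCoordinate g a b R u φ)
    (hg0 : g 0 = 0) (hφ : ∀ v ∈ Ioo (-R) R, deriv φ v + deriv φ (-v) = 2) :
    IsIsochronousCenter g := by
  have hP : ∀ r, 0 < r → r < R →
      ∫ s in (0 : ℝ)..2 * Real.pi, deriv φ (r * Real.sin s) = 2 * Real.pi := by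
    intro r hr hrR
    have h1 := integral_add_comp_neg_mul_sin h.continuousOn_deriv_inv hr hrR
    simp_rw [fun s => hφ _ (mul_sin_mem_Ioo hr hrR s)] at h1
    simp at h1
    linarith
  have hR2 : 0 < R / 2 := half_pos h.radius_pos
  have hev : ∀ᶠ x in 𝓝 (0 : ℝ), x ∈ Ioo a b ∧ |u x| < R / 2 := by
    refine Filter.Eventually.and (isOpen_Ioo.mem_nhds h.zero_mem) ?_
    have hc : ContinuousAt (fun x => |u x|) 0 := (h.hasDerivAt h.zero_mem).continuousAt.abs
    exact hc.eventually_lt continuousAt_const (by simpa [h.map_zero] using h.radius_pos)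
  obtain ⟨δ, hδ, hball⟩ := Metric.eventually_nhds_iff.mp hev
  refine ⟨hg0, 2 * Real.pi, min δ (R / 2), lt_min hδ hR2, fun x₀ y₀ hx₀ hy₀ hne => ?_⟩
  obtain ⟨hxI, hux⟩ := hball (y := x₀)
    (by rw [Real.dist_eq, sub_zero]; exact hx₀.trans_le (min_le_left _ _))
  have hxI' := Ioo_subset_Icc_self hxI
  -- Modulus and argument of `z` are the `r` and `α` of the orbit through `(x₀, y₀)`.
  set z : ℂ := ⟨y₀, u x₀⟩ with hz
  have hz0 : z ≠ 0 := by
    intro h0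
    have h1 : y₀ = 0 := congrArg Complex.re h0
    have h2 : u x₀ = 0 := congrArg Complex.im h0
    have h3 := h.left_inv hxI'
    rw [h2, h.inv_zero] at h3
    exact hne (by rw [← h3, h1])
  have hzR : ‖z‖ < R := by
    have h1 : ‖z‖ ≤ |y₀| + |u x₀| := Complex.norm_le_abs_re_add_abs_im z
    linarith [hy₀.trans_le (min_le_right δ (R / 2))]
  obtain ⟨x, y, hsol, hx0, hy0, hmin, -⟩ := h.exists_isSolution (norm_pos_iff.mpr hz0) hzR z.arg
  rw [hP _ (norm_pos_iff.mpr hz0) hzR] at hmin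
  rw [Complex.norm_mul_sin_arg] at hx0
  rw [Complex.norm_mul_cos_arg] at hy0
  exact ⟨x, y, hsol, hx0.trans (h.left_inv hxI'), hy0, hmin⟩

/-! ### The involution in the energy coordinate -/

variable {A : ℝ → ℝ}

theorem neg_mem_Icc {v : ℝ} (hv : v ∈ Icc (-R) R) : -v ∈ Icc (-R) R :=
  ⟨by linarith [hv.2], by linarith [hv.1]⟩

theorem isPotentialInvolution (h : IsEnergyCoordinate g a b R u φ) :
    IsPotentialInvolution g a b (fun x => φ (-u x)) where
  mapsTo x hx := h.mapsTo_inv (neg_mem_Icc (h.mapsTo hx))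
  involutive x hx := by
    simp only [h.right_inv _ (neg_mem_Icc (h.mapsTo hx)), neg_neg, h.left_inv hx]
  potential_eq x hx := by
    have hv := neg_mem_Icc (h.mapsTo hx)
    have h1 := h.sq_eq _ (h.mapsTo_inv hv)
    rw [h.right_inv _ hv, neg_sq, h.sq_eq x hx] at h1
    linarith
  mul_neg x hx hx0 := by
    have hv := neg_mem_Icc (h.mapsTo hx)
    have hz := Ioo_subset_Icc_self h.zero_mem
    have h1 := h.right_inv _ hv
    have h2 := h.map_zero
    rcases lt_or_gt_of_ne hx0 with hlt | hgt
    · have h3 := h.strictMonoOn hx hz hlt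
      have h4 : 0 < φ (-u x) :=
        (h.strictMonoOn.lt_iff_lt hz (h.mapsTo_inv hv)).mp (by linarith)
      exact mul_neg_of_pos_of_neg h4 hlt
    · have h3 := h.strictMonoOn hz hx hgt
      have h4 : φ (-u x) < 0 :=
        (h.strictMonoOn.lt_iff_lt (h.mapsTo_inv hv) hz).mp (by linarith)
      exact mul_neg_of_neg_of_pos h4 hgt
  analytic x hx :=
    (h.analytic_inv _ (neg_mem (h.mapsTo_Ioo hx))).comp (f := fun x => -u x) (h.analytic x hx).neg

/-- In the energy coordinate every involution attached to the potential is `v ↦ -v`. -/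
theorem apply_involution (h : IsEnergyCoordinate g a b R u φ)
    (hA : IsPotentialInvolution g a b A) {x : ℝ} (hx : x ∈ Icc a b) : u (A x) = -u x := by
  have hAx := hA.mapsTo hx
  have hsq : u (A x) ^ 2 = u x ^ 2 := by
    rw [h.sq_eq _ hAx, h.sq_eq _ hx, hA.potential_eq x hx]
  rcases sq_eq_sq_iff_eq_or_eq_neg.mp hsq with heq | heq
  · by_cases hx0 : x = 0
    · rw [heq, hx0, h.map_zero, neg_zero]
    -- Equal values of `u` would force `A x = x`, against the sign condition.
    · have h1 := hA.mul_neg x hx hx0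
      rw [h.strictMonoOn.injOn hAx hx heq] at h1
      exact absurd h1 (not_lt.mpr (mul_self_nonneg x))
  · exact heq

theorem involution_eq (h : IsEnergyCoordinate g a b R u φ)
    (hA : IsPotentialInvolution g a b A) {x : ℝ} (hx : x ∈ Icc a b) : A x = φ (-u x) := by
  rw [← h.apply_involution hA hx, h.left_inv (hA.mapsTo hx)]

theorem involution_mapsTo_Ioo (h : IsEnergyCoordinate g a b R u φ)
    (hA : IsPotentialInvolution g a b A) : MapsTo A (Ioo a b) (Ioo a b) := fun x hx => by
  rw [h.involution_eq hA (Ioo_subset_Icc_self hx)]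
  exact h.mapsTo_inv_Ioo (neg_mem (h.mapsTo_Ioo hx))

theorem deriv_involution (h : IsEnergyCoordinate g a b R u φ)
    (hA : IsPotentialInvolution g a b A) {x : ℝ} (hx : x ∈ Ioo a b) :
    deriv A x = -(deriv φ (-u x) * deriv u x) := by
  have h1 : HasDerivAt (fun x => φ (-u x)) (deriv φ (-u x) * -deriv u x) x :=
    (h.hasDerivAt_inv (neg_mem (h.mapsTo_Ioo hx))).comp x (h.hasDerivAt hx).neg
  have h2 : A =ᶠ[𝓝 x] fun x => φ (-u x) := by
    filter_upwards [isOpen_Ioo.mem_nhds hx] with y hy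
    exact h.involution_eq hA (Ioo_subset_Icc_self hy)
  rw [(h1.congr_of_eventuallyEq h2).deriv]
  ring

theorem deriv_involution_neg (h : IsEnergyCoordinate g a b R u φ)
    (hA : IsPotentialInvolution g a b A) {x : ℝ} (hx : x ∈ Ioo a b) : deriv A x < 0 := by
  rw [h.deriv_involution hA hx, neg_lt_zero]
  exact mul_pos (h.deriv_inv_pos (neg_mem (h.mapsTo_Ioo hx))) (h.deriv_pos x hx)

theorem one_sub_deriv_involution (h : IsEnergyCoordinate g a b R u φ)
    (hA : IsPotentialInvolution g a b A) {x : ℝ} (hx : x ∈ Ioo a b) :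
    1 - deriv A x = deriv u x * (deriv φ (u x) + deriv φ (-u x)) := by
  have h1 := h.deriv_mul_deriv_inv (h.mapsTo_Ioo hx)
  rw [h.left_inv (Ioo_subset_Icc_self hx)] at h1
  rw [h.deriv_involution hA hx, mul_add, h1]
  ring

/-! ### The differential equation for `G/g²` -/

theorem isIsochronousCenter_iff (h : IsEnergyCoordinate g a b R u φ)
    (hg : AnalyticOnNhd ℝ g (Ioo a b)) (hg0 : g 0 = 0) (hA : IsPotentialInvolution g a b A) :
    IsIsochronousCenter g ↔ ∀ x ∈ Ioo a b, 1 - deriv A x = 2 * deriv u x := by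
  constructor
  · intro hiso x hx
    rw [h.one_sub_deriv_involution hA hx,
      h.deriv_inv_add_of_isIsochronousCenter hg hiso _ (h.mapsTo_Ioo hx), mul_comm]
  · intro hx
    refine h.isIsochronousCenter_of_deriv_inv_add hg0 fun v hv => ?_
    have hφ := h.mapsTo_inv_Ioo hv
    have h1 := h.one_sub_deriv_involution hA hφ
    rw [hx _ hφ, h.right_inv v (Ioo_subset_Icc_self hv), mul_comm] at h1
    exact (mul_left_cancel₀ (h.deriv_pos _ hφ).ne' h1).symm

theorem potential_div_sq (h : IsEnergyCoordinate g a b R u φ) {x : ℝ} (hx : x ∈ Ioo a b)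
    (hx0 : x ≠ 0) : potential g x / g x ^ 2 = 1 / (2 * deriv u x ^ 2) := by
  have hu : u x ≠ 0 := by
    intro hu
    have h1 := h.left_inv (Ioo_subset_Icc_self hx)
    rw [hu, h.inv_zero] at h1
    exact hx0 h1.symm
  have hd := (h.deriv_pos x hx).ne'
  have hp : potential g x = u x ^ 2 / 2 := by
    linarith [h.sq_eq x (Ioo_subset_Icc_self hx)]
  rw [← h.mul_deriv x hx, hp]
  field_simp

theorem hasDerivAt_two_div_sq (h : IsEnergyCoordinate g a b R u φ)
    (hA : IsPotentialInvolution g a b A) {x : ℝ} (hx : x ∈ Ioo a b) :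
    HasDerivAt (fun z => 2 / (1 - deriv A z) ^ 2) (involutionExpr A x) x := by
  have hne : 1 - deriv A x ≠ 0 := by linarith [h.deriv_involution_neg hA hx]
  have h1 := (hA.analytic.deriv x hx).differentiableAt.hasDerivAt
  refine ((hasDerivAt_const x (2 : ℝ)).div ((h1.const_sub 1).pow 2)
    (pow_ne_zero 2 hne)).congr_deriv ?_
  simp only [involutionExpr]
  field_simp
  simp
  ring

theorem forall_hasDerivAt_potential_div_sq_iff (h : IsEnergyCoordinate g a b R u φ)
    (hA : IsPotentialInvolution g a b A) :
    (∀ x ∈ Ioo a b, x ≠ 0 →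
      HasDerivAt (fun z => potential g z / g z ^ 2) (involutionExpr A x) x) ↔
      ∀ x ∈ Ioo a b, 1 - deriv A x = 2 * deriv u x := by
  have hloc : ∀ x ∈ Ioo a b, x ≠ 0 →
      (fun z => potential g z / g z ^ 2) =ᶠ[𝓝 x] fun z => 1 / (2 * deriv u z ^ 2) := by
    intro x hx hx0
    filter_upwards [isOpen_Ioo.mem_nhds hx, isOpen_ne.mem_nhds hx0] with y hy hy0
    exact h.potential_div_sq hy hy0
  constructor
  · intro hder
    set F : ℝ → ℝ := fun z => 1 / (2 * deriv u z ^ 2) - 2 / (1 - deriv A z) ^ 2 with hF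
    have hAne : ∀ x ∈ Ioo a b, 0 < 1 - deriv A x := fun x hx => by
      linarith [h.deriv_involution_neg hA hx]
    have hFan : AnalyticOnNhd ℝ F (Ioo a b) := fun x hx =>
      (analyticAt_const.div (analyticAt_const.mul ((h.analytic.deriv x hx).pow 2))
        (mul_ne_zero two_ne_zero (pow_ne_zero 2 (h.deriv_pos x hx).ne'))).sub
      (analyticAt_const.div ((analyticAt_const.sub (hA.analytic.deriv x hx)).pow 2)
        (pow_ne_zero 2 (hAne x hx).ne'))
    have hF' : ∀ x ∈ Ioo a b, x ≠ 0 → deriv F x = 0 := fun x hx hx0 => by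
      have h1 := ((hder x hx hx0).congr_of_eventuallyEq (hloc x hx hx0).symm).sub
        (h.hasDerivAt_two_div_sq hA hx)
      rw [sub_self] at h1
      exact h1.deriv
    -- The equation is assumed only off 0; continuity of `F'` fills the gap.
    have hF'0 : deriv F 0 = 0 := by
      have h1 : Tendsto (deriv F) (𝓝[≠] 0) (𝓝 (deriv F 0)) :=
        (hFan.deriv 0 h.zero_mem).continuousAt.tendsto.mono_left nhdsWithin_le_nhds
      refine tendsto_nhds_unique h1 (tendsto_const_nhds.congr' ?_)
      filter_upwards [self_mem_nhdsWithin, nhdsWithin_le_nhds (isOpen_Ioo.mem_nhds h.zero_mem)]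
        with y hy hyI
      exact (hF' y hyI hy).symm
    -- Here `u'(0) = 1` and `1 - A'(0) = 2`, so both terms equal `1/2`.
    have hF0 : F 0 = 0 := by
      have h1 := h.one_sub_deriv_involution hA h.zero_mem
      rw [h.map_zero, neg_zero, h.deriv_inv_zero, h.deriv_zero] at h1
      simp only [hF, h1, h.deriv_zero]
      norm_num
    intro x hx
    have hFx : F x = 0 := by
      rw [← hF0]
      refine isOpen_Ioo.is_const_of_deriv_eq_zero isPreconnected_Ioo
        hFan.differentiableOn (fun y hy => ?_) hx h.zero_mem
      by_cases hy0 : y = 0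
      · rw [hy0]; exact hF'0
      · exact hF' y hy hy0
    have h1 := h.deriv_pos x hx
    have h2 := hAne x hx
    simp only [hF] at hFx
    rw [sub_eq_zero, div_eq_div_iff (by positivity) (by positivity)] at hFx
    refine (pow_left_inj₀ h2.le (by positivity) two_ne_zero).mp ?_
    linarith
  · intro hiso x hx hx0
    refine (h.hasDerivAt_two_div_sq hA hx).congr_of_eventuallyEq ((hloc x hx hx0).trans ?_)
    filter_upwards [isOpen_Ioo.mem_nhds hx] with y hy
    have h1 := (h.deriv_pos y hy).ne'
    rw [hiso y hy]
    field_simp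

/-! ### Invariance under the involution -/

theorem involutionExpr_involution (h : IsEnergyCoordinate g a b R u φ)
    (hA : IsPotentialInvolution g a b A) {x : ℝ} (hx : x ∈ Ioo a b) :
    involutionExpr A (A x) = involutionExpr A x := by
  have hd : ∀ y ∈ Ioo a b, HasDerivAt A (deriv A y) y :=
    fun y hy => (hA.analytic y hy).differentiableAt.hasDerivAt
  have hmul : ∀ y ∈ Ioo a b, deriv A (A y) * deriv A y = 1 := by
    intro y hy
    refine ((hd _ (h.involution_mapsTo_Ioo hA hy)).comp y (hd y hy)).unique
      ((hasDerivAt_id y).congr_of_eventuallyEq ?_)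
    filter_upwards [isOpen_Ioo.mem_nhds hy] with z hz
    exact hA.involutive z (Ioo_subset_Icc_self hz)
  have hAx := h.involution_mapsTo_Ioo hA hx
  have h1 : HasDerivAt (fun y => deriv A (A y) * deriv A y)
      (deriv (deriv A) (A x) * deriv A x * deriv A x + deriv A (A x) * deriv (deriv A) x) x :=
    ((hA.analytic.deriv _ hAx).differentiableAt.hasDerivAt.comp x (hd x hx)).mul
      (hA.analytic.deriv x hx).differentiableAt.hasDerivAt
  have h2 := h1.unique ((hasDerivAt_const x (1 : ℝ)).congr_of_eventuallyEq (by
    filter_upwards [isOpen_Ioo.mem_nhds hx] with y hy using hmul y hy))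
  have hneg := h.deriv_involution_neg hA hx
  have h3 := hmul x hx
  have hne : deriv A x ≠ 0 := hneg.ne
  have hinv : deriv A (A x) = 1 / deriv A x := by
    field_simp; exact h3
  -- The derivative of `A'(A) A' = 1`, solved for `A''(A)`. Its factor `-1/A'³` cancels against the
  -- same factor in `(1 - 1/A')³`.
  have h4 : deriv (deriv A) (A x) = -deriv (deriv A) x / deriv A x ^ 3 := by
    rw [hinv] at h2
    field_simp at h2 ⊢
    linarith
  have hne1 : 1 - deriv A x ≠ 0 := by linarith
  simp only [involutionExpr]
  rw [h4, hinv, show 1 - 1 / deriv A x = -(1 - deriv A x) / deriv A x by field_simp; ring]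
  field_simp

end IsEnergyCoordinate

theorem mainTheorem7 (g : ℝ → ℝ) (a b : ℝ)
    (hg : AnalyticOnNhd ℝ g (Set.Icc a b)) (hg0 : g 0 = 0) (hg1 : deriv g 0 = 1)
    (hwell : IsPotentialWell g a b) :
    (∃ A : ℝ → ℝ, IsPotentialInvolution g a b A) ∧
    ∀ A : ℝ → ℝ, IsPotentialInvolution g a b A →
      (IsIsochronousCenter g ↔
        ∀ x ∈ Set.Ioo a b, x ≠ 0 →
          HasDerivAt (fun z => potential g z / g z ^ 2) (involutionExpr A x) x) ∧
      ∀ x ∈ Set.Ioo a b, involutionExpr A (A x) = involutionExpr A x := by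
  obtain ⟨R, u, φ, h⟩ := exists_isEnergyCoordinate hg hg0 hg1 hwell
  refine ⟨⟨_, h.isPotentialInvolution⟩, fun A hA =>
    ⟨?_, fun x hx => h.involutionExpr_involution hA hx⟩⟩
  rw [h.isIsochronousCenter_iff (hg.mono Ioo_subset_Icc_self) hg0 hA,
    h.forall_hasDerivAt_potential_div_sq_iff hA]
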